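/- **Theorem 9.** Let $\alpha = (1+\sqrt5)/2$, $\beta = (1-\sqrt5)/2$ and $f(n) = \lfloor \alpha n + \beta^2 \rfloor$. The dual Wythoff array $(D_{i,j})_{i,j\ge 1}$ is defined row by row as follows: for every $i \ge 1$, $D_{i,1}$ is the least positive integer that is not in $\{ D_{i',j} : 1 \le i' < i,\ j \ge 1\}$; $D_{i,2} = f(D_{i,1})$; and $D_{i,n} = D_{i,n-1} + D_{i,n-2}$ for all $n \ge 3$. Then $D_{i,1} = \lceil \alpha^2 i - \alpha \rceil$ for all $i \ge 1$. Equivalently, $D_{1,1} = 1$ and $D_{i,1} = i + \lfloor \alpha (i-1) \rfloor + 1$ for all $i \ge 2$. -/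

import Mathlib

/-- The generalized Fibonacci sequence with starting values `a`, `b`, indexed from `1`:
the terms of index `1`, `2` are `a`, `b`, and each later term is the sum of the two terms
preceding it. The value at index `0` is a placeholder that is never used. -/
def genFib (a b : ℕ) : ℕ → ℕ
  | 0 => 0
  | 1 => a
  | 2 => b
  | n + 3 => genFib a b (n + 2) + genFib a b (n + 1)

/-- The least positive integer that does not belong to `S`. -/
noncomputable def mexPos (S : Set ℕ) : ℕ :=
  sInf {x : ℕ | 1 ≤ x ∧ x ∉ S}

/-- The first column (rows are indexed from `1`) of the array whose second column is the image
of the first one under `f` and whose rows are generalized Fibonacci sequences: the `i`-th entry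
is the least positive integer that appears in no preceding row. -/
noncomputable def firstColumn (f : ℕ → ℕ) (i : ℕ) : ℕ :=
  mexPos {x : ℕ | ∃ i' : ℕ, ∃ _ : 1 ≤ i' ∧ i' < i, ∃ j : ℕ, 1 ≤ j ∧
    x = genFib (firstColumn f i') (f (firstColumn f i')) j}
termination_by i
decreasing_by omega

/-- The array (rows `i ≥ 1`, columns `j ≥ 1`) determined by the function `f`. -/
noncomputable def fibArray (f : ℕ → ℕ) (i j : ℕ) : ℕ :=
  genFib (firstColumn f i) (f (firstColumn f i)) j

/-- The function `n ↦ ⌊α n + β²⌋`, where `α = (1 + √5) / 2` and `β = (1 - √5) / 2`. -/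
noncomputable def dualWythoffFun (n : ℕ) : ℕ :=
  ⌊Real.goldenRatio * (n : ℝ) + Real.goldenConj ^ 2⌋₊

/-- The dual Wythoff array `D i j`, for `i, j ≥ 1`. -/
noncomputable def dualWythoff (i j : ℕ) : ℕ :=
  fibArray dualWythoffFun i j

/-! Write f for `dualWythoffFun`. Since f(f(n)) = f(n) + n, each row is an f-orbit a, f(a), f(f(a)),
.... As n < f(n) for n ≥ 1, tracing back along f leads every positive integer to a row head outside
the image of f. So the first column lists the non-values of f in increasing order, and a Beatty-type
argument identifies these with ⌈α²i - α⌉. -/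

open Real in
theorem dualWythoffFun_eq_iff {n m : ℕ} :
    dualWythoffFun n = m ↔
      (m : ℝ) ≤ goldenRatio * n + goldenConj ^ 2 ∧ goldenRatio * n + goldenConj ^ 2 < m + 1 := by
  have h : 0 ≤ goldenRatio * (n : ℝ) + goldenConj ^ 2 := by
    have := goldenRatio_pos
    positivity
  rw [dualWythoffFun, Nat.floor_eq_iff h]

-- With m = f(n) and ε the fractional part of αn + β², the relation αβ = -1 gives αm + β² = m + n +
-- (1 - ε)/α, and 0 < (1 - ε)/α < 1.
open Real in
theorem dualWythoffFun_dualWythoffFun (n : ℕ) :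
    dualWythoffFun (dualWythoffFun n) = dualWythoffFun n + n := by
  obtain ⟨h₁, h₂⟩ := (dualWythoffFun_eq_iff (n := n)).1 rfl
  rw [dualWythoffFun_eq_iff]
  push_cast
  set m : ℝ := (dualWythoffFun n : ℝ)
  have hb : goldenConj = 1 - goldenRatio := by linarith [goldenRatio_add_goldenConj]
  have hq := goldenRatio_sq
  have h1 := one_lt_goldenRatio
  have h3 := goldenRatio_lt_two
  rw [hb] at h₁ h₂ ⊢
  constructor
  · nlinarith [mul_pos (sub_pos.2 h1) (sub_pos.2 h₂)]
  · nlinarith [mul_nonneg (sub_pos.2 h1).le (sub_nonneg.2 h₁)]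

open Real in
theorem lt_dualWythoffFun {n : ℕ} (hn : 1 ≤ n) : n < dualWythoffFun n := by
  obtain ⟨-, h⟩ := (dualWythoffFun_eq_iff (n := n)).1 rfl
  have hb : goldenConj = 1 - goldenRatio := by linarith [goldenRatio_add_goldenConj]
  have hq := goldenRatio_sq
  have h1 := one_lt_goldenRatio
  have hn' : (1 : ℝ) ≤ n := by exact_mod_cast hn
  rw [hb] at h
  have : (n : ℝ) < dualWythoffFun n := by nlinarith
  exact_mod_cast this

/-- The sequence `⌈α² i - α⌉`, complementary to `dualWythoffFun` on the positive integers. -/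
noncomputable def dualWythoffCompl (i : ℕ) : ℕ :=
  ⌈Real.goldenRatio ^ 2 * (i : ℝ) - Real.goldenRatio⌉₊

open Real in
theorem one_le_goldenRatio_sq_mul_sub {i : ℕ} (hi : 1 ≤ i) :
    1 ≤ goldenRatio ^ 2 * (i : ℝ) - goldenRatio := by
  have hi' : (1 : ℝ) ≤ i := by exact_mod_cast hi
  nlinarith [goldenRatio_sq, one_lt_goldenRatio]

open Real in
theorem dualWythoffCompl_eq_iff {i m : ℕ} (hm : 1 ≤ m) :
    dualWythoffCompl i = m ↔ (m : ℝ) - 1 < goldenRatio ^ 2 * (i : ℝ) - goldenRatio ∧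
      goldenRatio ^ 2 * (i : ℝ) - goldenRatio ≤ m := by
  rw [dualWythoffCompl, Nat.ceil_eq_iff (by omega), Nat.cast_sub hm, Nat.cast_one]

theorem one_le_dualWythoffCompl {i : ℕ} (hi : 1 ≤ i) : 1 ≤ dualWythoffCompl i :=
  Nat.one_le_ceil_iff.2 (by linarith [one_le_goldenRatio_sq_mul_sub hi])

open Real in
theorem dualWythoffCompl_strictMonoOn : StrictMonoOn dualWythoffCompl (Set.Ici 1) := by
  intro i hi j hj hij
  have hij' : (i : ℝ) + 1 ≤ j := by exact_mod_cast hij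
  rw [dualWythoffCompl, dualWythoffCompl, Nat.lt_ceil]
  have := Nat.ceil_lt_add_one
    (zero_le_one.trans (one_le_goldenRatio_sq_mul_sub hi))
  nlinarith [goldenRatio_sq, one_lt_goldenRatio]

open Real in
theorem dualWythoffCompl_ne_dualWythoffFun {i n : ℕ} (hi : 1 ≤ i) :
    dualWythoffCompl i ≠ dualWythoffFun n := by
  intro h
  obtain ⟨h₁, h₂⟩ := (dualWythoffCompl_eq_iff (one_le_dualWythoffCompl hi)).1 rfl
  obtain ⟨h₃, h₄⟩ := dualWythoffFun_eq_iff.1 h.symm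
  set m := dualWythoffCompl i
  have hb : goldenConj = 1 - goldenRatio := by linarith [goldenRatio_add_goldenConj]
  have hq := goldenRatio_sq
  have h1 := one_lt_goldenRatio
  have h5 := goldenRatio_lt_two
  rw [hb] at h₃ h₄
  -- scaled by `α²`, `n + i - m` lies strictly between `0` and `α²`
  have hlow : 0 < goldenRatio ^ 2 * ((n : ℝ) + i - m) := by
    nlinarith [mul_nonneg goldenRatio_pos.le (sub_nonneg.2 h₃)]
  have hupp : 0 < goldenRatio ^ 2 * ((m : ℝ) + 1 - (n + i)) := by
    nlinarith [mul_pos goldenRatio_pos (sub_pos.2 h₄)]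
  have hα : 0 < goldenRatio ^ 2 := by positivity
  have hlow' := pos_of_mul_pos_right hlow hα.le
  have hupp' := pos_of_mul_pos_right hupp hα.le
  have a : m < n + i := by exact_mod_cast sub_pos.1 hlow'
  have b : n + i < m + 1 := by exact_mod_cast sub_pos.1 hupp'
  omega

open Real in
theorem exists_eq_dualWythoffFun_or_dualWythoffCompl {m : ℕ} (hm : 1 ≤ m) :
    (∃ n, 1 ≤ n ∧ m = dualWythoffFun n) ∨ ∃ i, 1 ≤ i ∧ m = dualWythoffCompl i := by
  have hb : goldenConj = 1 - goldenRatio := by linarith [goldenRatio_add_goldenConj]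
  have hq := goldenRatio_sq
  have h1 := one_lt_goldenRatio
  have h5 := goldenRatio_lt_two
  have hm' : (1 : ℝ) ≤ m := by exact_mod_cast hm
  -- c solves αc + β² = m, so n = ⌈c⌉ is the first index whose value under f can reach m.
  set c : ℝ := (m - goldenConj ^ 2) / goldenRatio with hc
  have hcm : goldenRatio * c = m - goldenConj ^ 2 := by
    rw [hc]; field_simp
  have hb2 : goldenConj ^ 2 = 2 - goldenRatio := by rw [hb]; nlinarith
  have hcpos : 0 < c := pos_of_mul_pos_right (a := goldenRatio) (by rw [hcm]; linarith)
    (by linarith)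
  set n := ⌈c⌉₊
  have hn1 : 1 ≤ n := Nat.one_le_ceil_iff.2 hcpos
  have hcn : c ≤ n := Nat.le_ceil c
  have hnc : (n : ℝ) < c + 1 := Nat.ceil_lt_add_one hcpos.le
  rw [hb2] at hcm
  have hmn : goldenRatio * n ≥ m - (2 - goldenRatio) := by nlinarith
  have hnm : goldenRatio * n < m - (2 - goldenRatio) + goldenRatio := by nlinarith
  by_cases h : goldenRatio * n + goldenConj ^ 2 < m + 1
  · exact .inl ⟨n, hn1, (dualWythoffFun_eq_iff.2 ⟨by linarith, h⟩).symm⟩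
  · right
    rw [hb2] at h
    push Not at h
    have hle : n ≤ m := by
      have : (n : ℝ) < m + 1 := by nlinarith
      have : n < m + 1 := by exact_mod_cast this
      omega
    have hlow : (m : ℝ) - 1 < goldenRatio ^ 2 * ((m + 1 - n : ℕ) : ℝ) - goldenRatio := by
      rw [Nat.cast_sub (by omega)]
      push_cast
      nlinarith [mul_pos goldenRatio_pos (sub_pos.2 hnm)]
    -- Here f skips m: exactly the n - 1 values f(1), ..., f(n - 1) lie below it, so m is the (m -
    -- (n - 1))-th non-value.
    refine ⟨m + 1 - n, by omega, ((dualWythoffCompl_eq_iff hm).2 ⟨hlow, ?_⟩).symm⟩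
    rw [Nat.cast_sub (by omega)]
    push_cast
    nlinarith [mul_nonneg goldenRatio_pos.le (sub_nonneg.2 h)]

theorem genFib_eq_iterate {f : ℕ → ℕ} (hf : ∀ n, f (f n) = f n + n) (a j : ℕ) :
    genFib a (f a) (j + 1) = f^[j] a := by
  induction j using Nat.twoStepInduction with
  | zero => rfl
  | one => rfl
  | more j h₁ h₂ =>
    rw [genFib, h₁, h₂, Function.iterate_succ_apply', Function.iterate_succ_apply',
      Function.iterate_succ_apply', hf]

theorem mexPos_eq {S : Set ℕ} {a : ℕ} (ha : 1 ≤ a) (haS : a ∉ S)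
    (h : ∀ x, 1 ≤ x → x < a → x ∈ S) : mexPos S = a :=
  IsLeast.csInf_eq ⟨⟨ha, haS⟩, fun x hx ↦ not_lt.1 fun hxa ↦ hx.2 (h x hx.1 hxa)⟩

theorem firstColumn_eq_of_complementary {f g : ℕ → ℕ} (hf : ∀ n, f (f n) = f n + n)
    (hlt : ∀ n, 1 ≤ n → n < f n) (hg : ∀ i, 1 ≤ i → 1 ≤ g i)
    (hmono : StrictMonoOn g (Set.Ici 1)) (hne : ∀ i n, 1 ≤ i → g i ≠ f n)
    (hcover : ∀ m, 1 ≤ m → (∃ n, 1 ≤ n ∧ m = f n) ∨ ∃ i, 1 ≤ i ∧ m = g i)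
    {i : ℕ} (hi : 1 ≤ i) : firstColumn f i = g i := by
  induction i using Nat.strong_induction_on with
  | _ i ih =>
  rw [firstColumn]
  apply mexPos_eq (hg i hi)
  · rintro ⟨k, ⟨hk, hki⟩, j, hj, h⟩
    obtain ⟨j, rfl⟩ := Nat.exists_eq_add_of_le' hj
    rw [ih k hki hk, genFib_eq_iterate hf] at h
    cases j with
    | zero => exact (hmono hk hi hki).ne' h
    | succ j =>
      rw [Function.iterate_succ_apply'] at h
      exact hne i _ hi h
  · intro x
    induction x using Nat.strong_induction_on with
    | _ x ihx =>
    intro hx hxi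
    obtain ⟨n, hn, rfl⟩ | ⟨k, hk, rfl⟩ := hcover x hx
    -- The smaller number n already lies in an earlier row, and f(n) is the next entry of that row.
    · obtain ⟨k, ⟨hk, hki⟩, j, hj, h⟩ := ihx n (hlt n hn) hn ((hlt n hn).trans hxi)
      obtain ⟨j, rfl⟩ := Nat.exists_eq_add_of_le' hj
      refine ⟨k, ⟨hk, hki⟩, j + 1 + 1, by omega, ?_⟩
      rw [genFib_eq_iterate hf] at h ⊢
      rw [Function.iterate_succ_apply', ← h]
    · have hki : k < i := (hmono.lt_iff_lt hk hi).1 hxi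
      refine ⟨k, ⟨hk, hki⟩, 1, le_rfl, ?_⟩
      rw [ih k hki hk, genFib]

theorem dualWythoff_one {i : ℕ} (hi : 1 ≤ i) : dualWythoff i 1 = dualWythoffCompl i :=
  firstColumn_eq_of_complementary dualWythoffFun_dualWythoffFun (fun _ ↦ lt_dualWythoffFun)
    (fun _ ↦ one_le_dualWythoffCompl) dualWythoffCompl_strictMonoOn
    (fun _ _ ↦ dualWythoffCompl_ne_dualWythoffFun)
    (fun _ ↦ exists_eq_dualWythoffFun_or_dualWythoffCompl) hi

-- α²i - α = i + α(i - 1), which is irrational because i ≠ 1; hence its ceiling is its floor plus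
-- one.
open Real in
theorem ceil_goldenRatio_sq_mul_sub {i : ℕ} (hi : 2 ≤ i) :
    ⌈goldenRatio ^ 2 * (i : ℝ) - goldenRatio⌉ = (i : ℤ) + ⌊goldenRatio * ((i : ℝ) - 1)⌋ + 1 := by
  have hirr : Irrational (goldenRatio * ((i : ℝ) - 1)) := by
    have := goldenRatio_irrational.mul_natCast (m := i - 1) (by omega)
    rwa [Nat.cast_sub (by omega), Nat.cast_one] at this
  have hlt := (Int.floor_le (goldenRatio * ((i : ℝ) - 1))).lt_of_ne (hirr.ne_int _).symm
  have hle := (Int.lt_floor_add_one (goldenRatio * ((i : ℝ) - 1))).le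
  rw [Int.ceil_eq_iff, goldenRatio_sq]
  push_cast
  constructor <;> linarith

theorem theorem9 :
    (∀ i : ℕ, 1 ≤ i →
      (dualWythoff i 1 : ℤ) = ⌈Real.goldenRatio ^ 2 * (i : ℝ) - Real.goldenRatio⌉) ∧
    (dualWythoff 1 1 = 1 ∧ ∀ i : ℕ, 2 ≤ i →
      (dualWythoff i 1 : ℤ) = (i : ℤ) + ⌊Real.goldenRatio * ((i : ℝ) - 1)⌋ + 1) := by
  have key : ∀ i : ℕ, 1 ≤ i →
      (dualWythoff i 1 : ℤ) = ⌈Real.goldenRatio ^ 2 * (i : ℝ) - Real.goldenRatio⌉ := by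
    intro i hi
    rw [dualWythoff_one hi, dualWythoffCompl, Int.natCast_ceil_eq_ceil]
    linarith [one_le_goldenRatio_sq_mul_sub hi]
  refine ⟨key, ?_, fun i hi ↦ ?_⟩
  · have h := key 1 le_rfl
    rw [Real.goldenRatio_sq] at h
    norm_num at h
    exact_mod_cast h
  · rw [key i (by omega), ceil_goldenRatio_sq_mul_sub hi]
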